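/- Let $(X,d)$ be a complete separable metric space and let $E : X \to \mathbb{R}\cup\{+\infty\}$ be lower semicontinuous, with dense domain $D(E)=\{x\in X : E(x)<+\infty\}$, and bounded from below on every $d$-bounded subset of $X$. Let $\lambda\in\mathbb{R}$ and suppose that for every $x\in X$ there exists an $\mathrm{EVI}_\lambda$-gradient flow of $E$ starting from $x$, that is, a curve $(\gamma_t)_{t>0}$ in $X$, absolutely continuous on every compact subinterval of $(0,\infty)$, with $\gamma_t\to x\in\overline{D(E)}$ as $t\downarrow 0$ and such that, for every $y\in X$, $$\frac12\frac{d}{dt}d^2(\gamma_t,y)+\frac{\lambda}{2}d^2(\gamma_t,y)+E(\gamma_t)\le E(y)\qquad\text{for a.e. } t>0 .$$ Then $E$ is $\lambda$-convex along every geodesic: for every curve $\gamma:[0,1]\to X$ with $d(\gamma_t,\gamma_s)=|t-s|\,d(\gamma_0,\gamma_1)$ for all $s,t\in[0,1]$, $$E(\gamma_\theta)\le(1-\theta)E(\gamma_0)+\theta E(\gamma_1)-\frac{\lambda}{2}\theta(1-\theta)\,d^2(\gamma_0,\gamma_1)\qquad\text{for all }\theta\in[0,1],$$ with the convention $0\cdot(+\infty)=0$.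 -/

import Mathlib

open Set Filter Topology MeasureTheory

/-- The domain `D(E)`: the points where `E` is not `+∞`. -/
def energyDomain {X : Type*} (E : X → EReal) : Set X :=
  {x | E x ≠ ⊤}

/-- Standing assumptions on the functional `E : X → ℝ ∪ {+∞}`: lower semicontinuous, with dense
domain, and bounded below on bounded sets. -/
structure IsAdmissibleEnergy {X : Type*} [MetricSpace X] (E : X → EReal) : Prop where
  ne_bot : ∀ x, E x ≠ ⊥
  lowerSemicontinuous : LowerSemicontinuous E
  dense_domain : Dense (energyDomain E)
  bounded_below : ∀ B : Set X, Bornology.IsBounded B → ∃ c : ℝ, ∀ x ∈ B, (c : EReal) ≤ E x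

/-- `γ ∈ AC_loc((0,∞), X)`: absolutely continuous on every compact subinterval of `(0,∞)`.
Only the values of `γ` at positive times matter. -/
def LocallyACOnPos {X : Type*} [MetricSpace X] (γ : ℝ → X) : Prop :=
  ∀ a b : ℝ, 0 < a → a ≤ b → AbsolutelyContinuousOnInterval γ a b

/-- `(γ_t)_{t > 0}` is a gradient flow of `E` in the sense of the Evolution Variational Inequality
with parameter `lam`. The exceptional null set of times may depend on `y`. For a locally absolutely
continuous curve, `s ↦ d²(γ_s, y)` is differentiable at almost every `t > 0`, so `deriv` is the
actual derivative there. -/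
structure IsEVIFlow {X : Type*} [MetricSpace X] (E : X → EReal) (lam : ℝ) (γ : ℝ → X) :
    Prop where
  locallyAC : LocallyACOnPos γ
  evi : ∀ y : X, ∀ᵐ t : ℝ, 0 < t →
    ((1 / 2 * deriv (fun s => dist (γ s) y ^ 2) t + lam / 2 * dist (γ t) y ^ 2 : ℝ) : EReal)
      + E (γ t) ≤ E y

/-- The `EVI` gradient flow `γ` starts at `x`. -/
structure IsEVIFlowFrom {X : Type*} [MetricSpace X] (E : X → EReal) (lam : ℝ) (γ : ℝ → X)
    (x : X) : Prop where
  isEVIFlow : IsEVIFlow E lam γ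
  mem_closure : x ∈ closure (energyDomain E)
  tendsto : Tendsto γ (𝓝[>] 0) (𝓝 x)

/-- `γ` restricted to `[0,1]` is a (constant-speed, minimizing) geodesic. -/
def IsMetricGeodesic {X : Type*} [MetricSpace X] (γ : ℝ → X) : Prop :=
  ∀ s ∈ Icc (0 : ℝ) 1, ∀ t ∈ Icc (0 : ℝ) 1, dist (γ t) (γ s) = |t - s| * dist (γ 0) (γ 1)

/-- `E` is `lam`-convex along the curve `γ : [0,1] → X`, with the convention `0 * ∞ = 0`. -/
def IsLambdaConvexAlong {X : Type*} [MetricSpace X] (E : X → EReal) (lam : ℝ) (γ : ℝ → X) :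
    Prop :=
  ∀ θ ∈ Icc (0 : ℝ) 1,
    E (γ θ) ≤ ((1 - θ : ℝ) : EReal) * E (γ 0) + (θ : EReal) * E (γ 1)
      - ((lam / 2 * θ * (1 - θ) * dist (γ 0) (γ 1) ^ 2 : ℝ) : EReal)

/-!
Let `(γ_θ)` be a geodesic. For weights `1 - θ` and `θ`, the weighted sum of squared distances
`F z = (1 - θ) d²(z, γ_0) + θ d²(z, γ_1)` is minimal at `γ_θ`, where it equals
`θ (1 - θ) d²(γ_0, γ_1)`. Averaging the evolution variational inequalities for the two test points
`γ_0` and `γ_1` bounds the derivative of `F` along the flow `η` issuing from `γ_θ`: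
`1/2 (F ∘ η)' ≤ (1 - θ) E(γ_0) + θ E(γ_1) - λ/2 F(η) - E(η)`. If convexity failed at `γ_θ`, lower
semicontinuity of `E` would make the right-hand side negative and bounded away from zero for small
times, and `F ∘ η` would drop below the minimum from which it starts. The same argument proves
Jensen's inequality at any minimizer of a weighted sum of squared distances to finitely many points.
-/

section LocallyACOnPos

theorem absolutelyContinuousOnInterval_dist {X : Type*} [PseudoMetricSpace X] {γ : ℝ → X} {a b : ℝ}
    (hγ : AbsolutelyContinuousOnInterval γ a b) (y : X) :
    AbsolutelyContinuousOnInterval (fun s => dist (γ s) y) a b :=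
  squeeze_zero (fun _ => Finset.sum_nonneg fun _ _ => dist_nonneg)
    (fun _ => Finset.sum_le_sum fun _ _ => abs_dist_sub_le _ _ _) hγ

theorem LocallyACOnPos.dist_sq {X : Type*} [MetricSpace X] {γ : ℝ → X} (hγ : LocallyACOnPos γ)
    (y : X) : LocallyACOnPos fun s => dist (γ s) y ^ 2 := by
  intro a b ha hab
  have hdist := absolutelyContinuousOnInterval_dist (hγ a b ha hab) y
  simpa only [Pi.mul_def, sq] using hdist.mul hdist

variable {f : ℝ → ℝ}

theorem LocallyACOnPos.const_mul (hf : LocallyACOnPos f) (c : ℝ) :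
    LocallyACOnPos fun s => c * f s :=
  fun a b ha hab => (hf a b ha hab).const_mul c

theorem LocallyACOnPos.sum {ι : Type*} {s : Finset ι} {g : ι → ℝ → ℝ}
    (hg : ∀ i ∈ s, LocallyACOnPos (g i)) : LocallyACOnPos fun t => ∑ i ∈ s, g i t := by
  have hzero : LocallyACOnPos (0 : ℝ → ℝ) := fun _ _ _ _ =>
    (LipschitzWith.const (0 : ℝ)).lipschitzOnWith.absolutelyContinuousOnInterval
  have hadd : ∀ u v : ℝ → ℝ, LocallyACOnPos u → LocallyACOnPos v → LocallyACOnPos (u + v) :=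
    fun _ _ hu hv a b ha hab => (hu a b ha hab).add (hv a b ha hab)
  simpa only [Finset.sum_fn] using Finset.sum_induction g LocallyACOnPos hadd hzero hg

theorem LocallyACOnPos.ae_differentiableAt (hf : LocallyACOnPos f) :
    ∀ᵐ t : ℝ, 0 < t → DifferentiableAt ℝ f t := by
  have hIcc : ∀ n : ℕ, ∀ᵐ t : ℝ,
      t ∈ uIcc (1 / ((n : ℝ) + 1)) (1 / ((n : ℝ) + 1) + n) → DifferentiableAt ℝ f t :=
    fun n => (hf _ _ (by positivity) (by simp)).ae_differentiableAt
  filter_upwards [ae_all_iff.2 hIcc] with t ht h0t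
  obtain ⟨k, hk⟩ := exists_nat_one_div_lt h0t
  obtain ⟨n, hn⟩ := exists_nat_ge (max t k)
  have hkn : 1 / ((n : ℝ) + 1) ≤ 1 / ((k : ℝ) + 1) :=
    one_div_le_one_div_of_le (by positivity) (by linarith [(le_max_right t k).trans hn])
  refine ht n (mem_uIcc_of_le (hkn.trans hk.le) ?_)
  linarith [(le_max_left t k).trans hn, show 0 < 1 / ((n : ℝ) + 1) by positivity]

theorem sub_le_of_ae_deriv_le {a b c : ℝ} (hab : a ≤ b) (hf : AbsolutelyContinuousOnInterval f a b)
    (hc : ∀ᵐ t : ℝ, t ∈ Icc a b → deriv f t ≤ c) : f b - f a ≤ c * (b - a) := by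
  rw [← hf.integral_deriv_eq_sub]
  calc ∫ t in a..b, deriv f t ≤ ∫ _ in a..b, c :=
        intervalIntegral.integral_mono_ae_restrict hab hf.intervalIntegrable_deriv
          intervalIntegrable_const ((ae_restrict_iff' measurableSet_Icc).2 hc)
    _ = c * (b - a) := by rw [intervalIntegral.integral_const, smul_eq_mul, mul_comm]

theorem LocallyACOnPos.le_add_mul_of_ae_deriv_le {l c δ : ℝ} (hf : LocallyACOnPos f)
    (hl : Tendsto f (𝓝[>] 0) (𝓝 l)) (hδ : 0 < δ)
    (hc : ∀ᵐ t : ℝ, t ∈ Ioc 0 δ → deriv f t ≤ c) : f δ ≤ l + c * δ := by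
  have hsub : ∀ s ∈ Ioc 0 δ, f δ ≤ f s + c * (δ - s) := by
    intro s hs
    have hcs : ∀ᵐ t : ℝ, t ∈ Icc s δ → deriv f t ≤ c :=
      hc.mono fun t ht hts => ht ⟨hs.1.trans_le hts.1, hts.2⟩
    linarith [sub_le_of_ae_deriv_le hs.2 (hf s δ hs.1 hs.2) hcs]
  have hid : Tendsto (fun s : ℝ => s) (𝓝[>] 0) (𝓝 0) := nhdsWithin_le_nhds
  have hlim := hl.add ((hid.const_sub δ).const_mul c)
  rw [sub_zero] at hlim
  exact ge_of_tendsto hlim (mem_of_superset (Ioc_mem_nhdsGT hδ) hsub)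

end LocallyACOnPos

section FrechetFunctional

variable {X ι : Type*} [Fintype ι]

/-- The Fréchet functional `z ↦ ∑ i, w i * d²(z, y i)` of the points `y i` with weights `w i`. Its
minimizers are the barycenters of the weighted points. -/
def frechetFunctional [PseudoMetricSpace X] (w : ι → ℝ) (y : ι → X) (z : X) : ℝ :=
  ∑ i, w i * dist z (y i) ^ 2

theorem continuous_frechetFunctional [PseudoMetricSpace X] (w : ι → ℝ) (y : ι → X) :
    Continuous (frechetFunctional w y) := by
  unfold frechetFunctional
  fun_prop

variable [MetricSpace X] {E : X → EReal} {lam : ℝ} {η : ℝ → X} {w e : ι → ℝ} {y : ι → X}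

theorem LocallyACOnPos.frechetFunctional_comp (hη : LocallyACOnPos η) (w : ι → ℝ) (y : ι → X) :
    LocallyACOnPos fun s => frechetFunctional w y (η s) :=
  LocallyACOnPos.sum fun i _ => (hη.dist_sq (y i)).const_mul (w i)

theorem LocallyACOnPos.ae_deriv_frechetFunctional_comp (hη : LocallyACOnPos η) (w : ι → ℝ)
    (y : ι → X) : ∀ᵐ t : ℝ, 0 < t →
      deriv (fun s => frechetFunctional w y (η s)) t
        = ∑ i, w i * deriv (fun s => dist (η s) (y i) ^ 2) t := by
  filter_upwards [ae_all_iff.2 fun i => (hη.dist_sq (y i)).ae_differentiableAt] with t hdiff ht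
  simp only [frechetFunctional]
  rw [deriv_fun_sum fun i _ => (hdiff i ht).const_mul (w i)]
  simp only [deriv_const_mul_field]

theorem IsEVIFlow.ae_energy_le (hη : IsEVIFlow E lam η) {z : X} {r : ℝ} (hr : E z ≤ r) :
    ∀ᵐ t : ℝ, 0 < t → E (η t) ≤
      ((r - 1 / 2 * deriv (fun s => dist (η s) z ^ 2) t - lam / 2 * dist (η t) z ^ 2 : ℝ) :
        EReal) := by
  filter_upwards [hη.evi z] with t ht h0t
  rw [sub_sub, EReal.coe_sub,
    EReal.le_sub_iff_add_le (Or.inl (EReal.coe_ne_bot _)) (Or.inl (EReal.coe_ne_top _)), add_comm]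
  exact (ht h0t).trans hr

theorem le_coe_sum_mul_of_forall_le {c : EReal} {a : ι → ℝ} (hw : ∀ i, 0 ≤ w i)
    (hw1 : ∑ i, w i = 1) (hc : ∀ i, c ≤ a i) : c ≤ ((∑ i, w i * a i : ℝ) : EReal) := by
  have hupper : IsUpperSet {r : ℝ | c ≤ (r : EReal)} :=
    fun _ _ hab ha => le_trans ha (EReal.coe_le_coe_iff.2 hab)
  exact hupper.ordConnected.convex.sum_mem (fun i _ => hw i) hw1 fun i _ => hc i

theorem IsEVIFlow.ae_energy_le_frechetFunctional (hη : IsEVIFlow E lam η) (hw : ∀ i, 0 ≤ w i)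
    (hw1 : ∑ i, w i = 1) (he : ∀ i, E (y i) ≤ e i) :
    ∀ᵐ t : ℝ, 0 < t → E (η t) ≤
      ((∑ i, w i * e i - 1 / 2 * deriv (fun s => frechetFunctional w y (η s)) t
        - lam / 2 * frechetFunctional w y (η t) : ℝ) : EReal) := by
  filter_upwards [ae_all_iff.2 fun i => hη.ae_energy_le (he i),
    hη.locallyAC.ae_deriv_frechetFunctional_comp w y] with t henergy hderiv ht
  convert le_coe_sum_mul_of_forall_le hw hw1 fun i => henergy i ht using 2
  rw [hderiv ht]
  simp only [frechetFunctional, Finset.mul_sum, ← Finset.sum_sub_distrib]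
  exact Finset.sum_congr rfl fun i _ => by ring

theorem IsEVIFlow.jensen_of_forall_frechetFunctional_le {x : X} (hη : IsEVIFlow E lam η)
    (hx : Tendsto η (𝓝[>] 0) (𝓝 x)) (hE : LowerSemicontinuousAt E x) (hw : ∀ i, 0 ≤ w i)
    (hw1 : ∑ i, w i = 1) (he : ∀ i, E (y i) ≤ e i)
    (hmin : ∀ z, frechetFunctional w y x ≤ frechetFunctional w y z) :
    E x ≤ ((∑ i, w i * e i - lam / 2 * frechetFunctional w y x : ℝ) : EReal) := by
  set F := frechetFunctional w y
  set K : ℝ := ∑ i, w i * e i - lam / 2 * F x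
  by_contra! hlt
  obtain ⟨m, hKm, hmE⟩ := EReal.lt_iff_exists_real_btwn.1 hlt
  replace hKm : K < m := EReal.coe_lt_coe_iff.1 hKm
  have hFlim : Tendsto (fun s => F (η s)) (𝓝[>] 0) (𝓝 (F x)) :=
    ((continuous_frechetFunctional w y).tendsto x).comp hx
  have hKlim : Tendsto (fun s => ∑ i, w i * e i - lam / 2 * F (η s)) (𝓝[>] 0) (𝓝 K) :=
    (hFlim.const_mul _).const_sub _
  have hsmall : ∀ᶠ s in 𝓝[>] (0 : ℝ),
      m < E (η s) ∧ ∑ i, w i * e i - lam / 2 * F (η s) < (K + m) / 2 :=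
    (hx.eventually (hE m hmE)).and (hKlim.eventually_lt_const (by linarith))
  obtain ⟨δ, hδ, hsub⟩ := mem_nhdsGT_iff_exists_Ioc_subset.1 hsmall
  have hdecay : F (η δ) ≤ F x + (K - m) * δ := by
    refine (hη.locallyAC.frechetFunctional_comp w y).le_add_mul_of_ae_deriv_le hFlim hδ ?_
    filter_upwards [hη.ae_energy_le_frechetFunctional hw hw1 he] with t henergy ht
    obtain ⟨hmt, hKt⟩ := hsub ht
    have hderiv := EReal.coe_lt_coe_iff.1 (hmt.trans_le (henergy ht.1))
    linarith
  have hneg : (K - m) * δ < 0 := mul_neg_of_neg_of_pos (sub_neg.2 hKm) hδ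
  linarith [hmin (η δ)]

end FrechetFunctional

section Geodesic

theorem mul_dist_sq_le_combination {X : Type*} [PseudoMetricSpace X] (x y z : X) {θ : ℝ}
    (hθ : θ ∈ Icc (0 : ℝ) 1) :
    θ * (1 - θ) * dist x y ^ 2 ≤ (1 - θ) * dist z x ^ 2 + θ * dist z y ^ 2 := by
  have hsq : dist x y ^ 2 ≤ (dist z x + dist z y) ^ 2 :=
    pow_le_pow_left₀ dist_nonneg (dist_triangle_left x y z) 2
  calc θ * (1 - θ) * dist x y ^ 2 ≤ θ * (1 - θ) * (dist z x + dist z y) ^ 2 :=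
        mul_le_mul_of_nonneg_left hsq (mul_nonneg hθ.1 (sub_nonneg.2 hθ.2))
    _ ≤ (1 - θ) * dist z x ^ 2 + θ * dist z y ^ 2 := by
        linarith [sq_nonneg ((1 - θ) * dist z x - θ * dist z y)]

variable {X : Type*} [MetricSpace X] {γ : ℝ → X} {θ : ℝ}

theorem IsMetricGeodesic.frechetFunctional_eq (hγ : IsMetricGeodesic γ) (hθ : θ ∈ Icc (0 : ℝ) 1) :
    frechetFunctional ![1 - θ, θ] ![γ 0, γ 1] (γ θ) = θ * (1 - θ) * dist (γ 0) (γ 1) ^ 2 := by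
  have h0 : dist (γ θ) (γ 0) = θ * dist (γ 0) (γ 1) := by
    rw [hγ 0 (by simp) θ hθ, sub_zero, abs_of_nonneg hθ.1]
  have h1 : dist (γ θ) (γ 1) = (1 - θ) * dist (γ 0) (γ 1) := by
    rw [hγ 1 (by simp) θ hθ, abs_sub_comm, abs_of_nonneg (sub_nonneg.2 hθ.2)]
  simp only [frechetFunctional, Fin.sum_univ_two, Matrix.cons_val_zero, Matrix.cons_val_one, h0, h1]
  ring

theorem IsMetricGeodesic.frechetFunctional_le (hγ : IsMetricGeodesic γ) (hθ : θ ∈ Icc (0 : ℝ) 1)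
    (z : X) : frechetFunctional ![1 - θ, θ] ![γ 0, γ 1] (γ θ)
      ≤ frechetFunctional ![1 - θ, θ] ![γ 0, γ 1] z := by
  rw [hγ.frechetFunctional_eq hθ]
  simpa only [frechetFunctional, Fin.sum_univ_two, Matrix.cons_val_zero, Matrix.cons_val_one] using
    mul_dist_sq_le_combination (γ 0) (γ 1) z hθ

theorem IsMetricGeodesic.energy_le {E : X → EReal} {lam a b : ℝ} {η : ℝ → X}
    (hγ : IsMetricGeodesic γ) (hθ : θ ∈ Icc (0 : ℝ) 1) (hE : LowerSemicontinuousAt E (γ θ))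
    (hη : IsEVIFlow E lam η) (hlim : Tendsto η (𝓝[>] 0) (𝓝 (γ θ))) (ha : E (γ 0) ≤ a)
    (hb : E (γ 1) ≤ b) :
    E (γ θ) ≤
      (((1 - θ) * a + θ * b - lam / 2 * θ * (1 - θ) * dist (γ 0) (γ 1) ^ 2 : ℝ) : EReal) := by
  have hw : ∀ i, 0 ≤ ![1 - θ, θ] i := Fin.forall_fin_two.2 ⟨sub_nonneg.2 hθ.2, hθ.1⟩
  have hw1 : ∑ i, ![1 - θ, θ] i = 1 := by simp
  have he : ∀ i, E (![γ 0, γ 1] i) ≤ ((![a, b] i : ℝ) : EReal) := Fin.forall_fin_two.2 ⟨ha, hb⟩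
  have hjensen :=
    hη.jensen_of_forall_frechetFunctional_le hlim hE hw hw1 he (hγ.frechetFunctional_le hθ)
  rw [hγ.frechetFunctional_eq hθ] at hjensen
  simpa [mul_assoc] using hjensen

end Geodesic

theorem le_combination_sub_of_forall_real {a b c : EReal} {s t r : ℝ} (hs : 0 < s) (ht : 0 < t)
    (ha : a ≠ ⊥) (hb : b ≠ ⊥)
    (h : ∀ a' b' : ℝ, a ≤ a' → b ≤ b' → c ≤ ((s * a' + t * b' - r : ℝ) : EReal)) :
    c ≤ (s : EReal) * a + (t : EReal) * b - (r : EReal) := by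
  have hsa : (s : EReal) * a ≠ ⊥ := by
    simp [EReal.mul_ne_bot, ha, hs.le]
  have htb : (t : EReal) * b ≠ ⊥ := by
    simp [EReal.mul_ne_bot, hb, ht.le]
  induction a with
  | bot => exact absurd rfl ha
  | top =>
    rw [EReal.coe_mul_top_of_pos hs, EReal.top_add_of_ne_bot htb, EReal.top_sub_coe]
    exact le_top
  | coe a' =>
    induction b with
    | bot => exact absurd rfl hb
    | top =>
      rw [EReal.coe_mul_top_of_pos ht, EReal.add_top_of_ne_bot hsa, EReal.top_sub_coe]
      exact le_top
    | coe b' => exact_mod_cast h a' b' le_rfl le_rfl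

theorem theorem4p6_general {X : Type*} [MetricSpace X] {E : X → EReal} {lam : ℝ} {γ : ℝ → X}
    (hbot : ∀ x, E x ≠ ⊥) (hE : LowerSemicontinuous E) (hγ : IsMetricGeodesic γ)
    (hflow : ∀ θ ∈ Ioo (0 : ℝ) 1,
      ∃ η : ℝ → X, IsEVIFlow E lam η ∧ Tendsto η (𝓝[>] 0) (𝓝 (γ θ))) :
    IsLambdaConvexAlong E lam γ := by
  intro θ hθ
  rcases eq_endpoints_or_mem_Ioo_of_mem_Icc hθ with rfl | rfl | hθ'
  · simp
  · simp
  obtain ⟨η, hη, hlim⟩ := hflow θ hθ'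
  exact le_combination_sub_of_forall_real (sub_pos.2 hθ'.2) hθ'.1 (hbot _) (hbot _)
    fun _ _ => hγ.energy_le hθ (hE _) hη hlim

theorem theorem4p6 {X : Type*} [MetricSpace X] [CompleteSpace X]
    [TopologicalSpace.SeparableSpace X] (E : X → EReal) (hE : IsAdmissibleEnergy E) (lam : ℝ)
    (hflow : ∀ x : X, ∃ γ : ℝ → X, IsEVIFlowFrom E lam γ x) :
    ∀ γ : ℝ → X, IsMetricGeodesic γ → IsLambdaConvexAlong E lam γ := by
  intro γ hγ
  exact theorem4p6_general hE.ne_bot hE.lowerSemicontinuous hγ fun θ _ =>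
    (hflow (γ θ)).imp fun _ hη => ⟨hη.isEVIFlow, hη.tendsto⟩
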